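/- Let $W=W_0$ be the principal branch of the Lambert $W$ function: for $z\in\mathbb C$, $W(z)$ is the solution $w=u+iv$ of $we^w=z$ with either $v=0$ and $u\ge -1$, or $0<v<\pi$ and $u\ge -v\cot v$, or $-\pi<v<0$ and $u>-v\cot v$. Then for every complex $z\neq 0$ with $|\arg z|<\pi$ (that is, $z\in\mathbb C\setminus(-\infty,0]$), $$\frac{W(z)}{z}=\frac1\pi\int_0^\pi\frac{v^2+(1-v\cot v)^2}{z+v\csc (v)\,e^{-v\cot v}}\,dv ,$$ the integral being absolutely convergent. This is a Stieltjes integral: if $\mu$ denotes the image of the measure $\frac1\pi\,[v^2+(1-v\cot v)^2]\,dv$ on $(0,\pi)$ under the map $v\mapsto v\csc (v)\,e^{-v\cot v}$, then $\mu$ is a positive measure on $[0,\infty)$ with $\int_0^\infty (1+t)^{-1}\,d\mu(t)<\infty$, and $$\frac{W(z)}{z}=\int_0^\infty\frac{d\mu(t)}{z+t}\qquad(z\ne 0,\ |\arg z|<\pi).$$ -/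

import Mathlib

open MeasureTheory

/-- The range of the principal branch `W₀` of the Lambert `W` function: the points `u + iv` with
`-π < v < π` that lie to the right of the curve `u = -v cot v` (which passes through `-1` at
`v = 0`). The upper half of the curve and the point `-1` belong to the range, the lower half does
not; so on the cut `(-∞, -1/e]` the branch takes the limit values from above. -/
def lambertWRange : Set ℂ :=
  {w | (w.im = 0 ∧ -1 ≤ w.re) ∨
       (0 < w.im ∧ w.im < Real.pi ∧ -(w.im * Real.cot w.im) ≤ w.re) ∨
       (-Real.pi < w.im ∧ w.im < 0 ∧ -(w.im * Real.cot w.im) < w.re)}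

/-- The principal branch `W = W₀` of the Lambert `W` function: the inverse of `w ↦ w * exp w`
on the range of the principal branch. -/
noncomputable def lambertW : ℂ → ℂ :=
  Function.invFunOn (fun w : ℂ => w * Complex.exp w) lambertWRange

/-- `f(z) = a + ∫ dμ(t) / (z + t)` for `|arg z| < π`, where `a ≥ 0` and `μ` is a positive measure
on `[0, ∞)` (a measure on `ℝ` that gives no mass to the negative reals) with
`∫ dμ(t) / (1 + t) < ∞`. -/
def HasStieltjesRepresentation (f : ℂ → ℂ) (a : ℝ) (μ : Measure ℝ) : Prop :=
  0 ≤ a ∧ μ (Set.Iio 0) = 0 ∧ ∫⁻ t, ENNReal.ofReal (1 / (1 + t)) ∂μ < ⊤ ∧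
    ∀ z : ℂ, z ≠ 0 → |z.arg| < Real.pi →
      Integrable (fun t : ℝ => 1 / (z + (t : ℂ))) μ ∧ f z = a + ∫ t : ℝ, 1 / (z + (t : ℂ)) ∂μ

open Set Filter Topology ComplexConjugate

/-! For `w = W(z)` one has `W(z)/z = exp (-w)`, and `exp (-w)` is the residue at `w` of `F(ζ) = (1 +
ζ) / (ζ * exp ζ - z)`: the numerator cancels the factor `1 + w` of the derivative `(1 + w) * exp w`.
The proof integrates `F` upwards along the boundary `γ(v) = -v cot v + iv` of the range of `W`.

On `γ` the value `ζ * exp ζ` is real and negative, equal to minus `lambertCut v`. Since `γ(-v)` is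
the conjugate of `γ(v)`, the parameters `v` and `-v` together contribute `-2i` times the integrand
of the theorem (`lambertCurve_integrand_add_neg`).

The region right of `γ` contains no pole other than `w`, because `ζ * exp ζ` takes each value off
the cut at most once there (`eq_of_mul_exp_eq`). The curve runs clockwise around the region, so its
integral is `-2πi * exp (-w)` (`tendsto_integral_lambertCurve`). To prove this, `F` is split as
`G(ζ) + exp (-w) / (ζ - w)` with `G` holomorphic on the region. The polar term has a logarithm as
primitive, whose increment tends to `-2πi`. The integral of `G` is shown to vanish in the limit by
translating the curve to the right (`integral_curve_eq_integral_translate`) and bounding the two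
horizontal sides jointly.

The Stieltjes form follows by a change of variables under `lambertCut`; integrability comes from the
bound `lambertWeight_div_le`. -/

/-! ### Cauchy's theorem between a curve and its translate -/

/-- Moving a curve by a real translation changes the integral of a holomorphic function by the
integrals over the two horizontal segments that the end points describe. -/
theorem integral_curve_eq_integral_translate {G : ℂ → ℂ} {γ γ' γ'' : ℝ → ℂ} {a b S : ℝ}
    (hab : a ≤ b) (hS : 0 ≤ S) (hγ : ∀ v ∈ Icc a b, HasDerivAt γ (γ' v) v)
    (hγ' : ∀ v ∈ Icc a b, HasDerivAt γ' (γ'' v) v)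
    (hG : ∀ s : ℝ, 0 ≤ s → ∀ v ∈ Icc a b, DifferentiableAt ℂ G (s + γ v)) :
    ∫ v in a..b, G (γ v) * γ' v =
      (∫ v in a..b, G (S + γ v) * γ' v) - (∫ s in (0 : ℝ)..S, G (s + γ b))
        + ∫ s in (0 : ℝ)..S, G (s + γ a) := by
  set Φ : ℝ × ℝ → ℂ := fun p => p.1 + γ p.2 with hΦ
  set L : ℝ → ℝ × ℝ →L[ℝ] ℂ := fun v =>
    Complex.ofRealCLM.comp (ContinuousLinearMap.fst ℝ ℝ ℝ)
      + (ContinuousLinearMap.snd ℝ ℝ ℝ).smulRight (γ' v) with hL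
  have hΦd : ∀ p : ℝ × ℝ, p.2 ∈ Icc a b → HasFDerivAt Φ (L p.2) p := by
    intro p hp
    have h1 : HasFDerivAt (fun p : ℝ × ℝ => (p.1 : ℂ))
        (Complex.ofRealCLM.comp (ContinuousLinearMap.fst ℝ ℝ ℝ)) p :=
      Complex.ofRealCLM.hasFDerivAt.comp p hasFDerivAt_fst
    have h2 := (hγ p.2 hp).hasFDerivAt.comp p (hasFDerivAt_snd (𝕜 := ℝ) (E := ℝ) (F := ℝ))
    refine (h1.add h2).congr_fderiv ?_
    ext <;> simp [hL]
  have hGd : ∀ p : ℝ × ℝ, 0 ≤ p.1 → p.2 ∈ Icc a b →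
      HasFDerivAt (fun p => G (Φ p)) (deriv G (Φ p) • L p.2) p := fun p h1 h2 =>
    (hG p.1 h1 p.2 h2).hasDerivAt.comp_hasFDerivAt p (hΦd p h2)
  have hγd : ∀ p : ℝ × ℝ, p.2 ∈ Icc a b → HasFDerivAt (fun p : ℝ × ℝ => γ' p.2)
      ((ContinuousLinearMap.snd ℝ ℝ ℝ).smulRight (γ'' p.2)) p := by
    intro p hp
    have h2 := (hγ' p.2 hp).hasFDerivAt.comp p (hasFDerivAt_snd (𝕜 := ℝ) (E := ℝ) (F := ℝ))
    refine h2.congr_fderiv ?_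
    ext <;> simp
  have hfd : ∀ p : ℝ × ℝ, 0 ≤ p.1 → p.2 ∈ Icc a b →
      HasFDerivAt (fun p => G (Φ p) * γ' p.2) _ p := fun p h1 h2 =>
    (hGd p h1 h2).mul (hγd p h2)
  have hgd : ∀ p : ℝ × ℝ, 0 ≤ p.1 → p.2 ∈ Icc a b →
      HasFDerivAt (fun p => -G (Φ p)) _ p := fun p h1 h2 => (hGd p h1 h2).neg
  -- The Cauchy–Riemann equations: the field `(G γ', -G)` in the coordinates `(s, v)` is divergence
  -- free. The term with `γ''` drops out because `γ'` does not depend on `s`.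
  have hdiv : ∀ p : ℝ × ℝ,
      (G (Φ p) • (ContinuousLinearMap.snd ℝ ℝ ℝ).smulRight (γ'' p.2)
        + γ' p.2 • (deriv G (Φ p) • L p.2)) (1, 0) + (-(deriv G (Φ p) • L p.2)) (0, 1) = 0 := by
    intro p
    simp [hL]
    ring
  have key := integral2_divergence_prod_of_hasFDerivAt (fun p => G (Φ p) * γ' p.2)
    (fun p => -G (Φ p)) _ _ 0 a S b
    (fun p hp => by
      rw [uIcc_of_le hS, uIcc_of_le hab] at hp
      exact (hfd p hp.1.1 hp.2).continuousAt.continuousWithinAt)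
    (fun p hp => by
      rw [uIcc_of_le hS, uIcc_of_le hab] at hp
      exact (hgd p hp.1.1 hp.2).continuousAt.continuousWithinAt)
    (fun p hp => by
      rw [min_eq_left hS, max_eq_right hS, min_eq_left hab, max_eq_right hab] at hp
      exact hfd p hp.1.1.le (Ioo_subset_Icc_self hp.2))
    (fun p hp => by
      rw [min_eq_left hS, max_eq_right hS, min_eq_left hab, max_eq_right hab] at hp
      exact hgd p hp.1.1.le (Ioo_subset_Icc_self hp.2))
    (by simp_rw [hdiv]; exact integrableOn_zero)
  simp_rw [hdiv] at key
  simp only [hΦ, intervalIntegral.integral_zero, intervalIntegral.integral_neg,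
    Complex.ofReal_zero, zero_add] at key
  linear_combination key

/-! ### Injectivity of `w * exp w` on the upper strip -/

/-- Pass to `log w + w`. Its derivative `1/w + 1` has negative imaginary part in the upper
half-plane, so Rolle's theorem along a segment excludes two equal values. -/
theorem Complex.injOn_mul_exp_strip :
    InjOn (fun w : ℂ => w * Complex.exp w) {w | 0 < w.im ∧ w.im < Real.pi} := by
  rintro a ⟨ha0, haπ⟩ b ⟨hb0, hbπ⟩ hab
  have hne : ∀ {c : ℂ}, 0 < c.im → c ≠ 0 := fun h h0 => by simp [h0] at h
  have hexp : Complex.exp (Complex.log a + a) = Complex.exp (Complex.log b + b) := by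
    rw [Complex.exp_add, Complex.exp_add, Complex.exp_log (hne ha0), Complex.exp_log (hne hb0)]
    exact hab
  obtain ⟨n, hn⟩ := Complex.exp_eq_exp_iff_exists_int.1 hexp
  have him := congrArg Complex.im hn
  simp only [Complex.add_im, Complex.log_im, Complex.mul_im, Complex.mul_re, Complex.intCast_re,
    Complex.intCast_im, Complex.ofReal_re, Complex.ofReal_im, Complex.I_re, Complex.I_im,
    Complex.re_ofNat, Complex.im_ofNat] at him
  have ha1 := Complex.arg_nonneg_iff.2 ha0.le
  have hb1 := Complex.arg_nonneg_iff.2 hb0.le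
  have ha2 := Complex.arg_le_pi a
  have hb2 := Complex.arg_le_pi b
  -- Both `arg + im` lie strictly between `0` and `2π`, so they cannot differ by a nonzero multiple
  -- of `2π`.
  have hn0 : n = 0 := by
    have h1 : (n : ℝ) < 1 := by nlinarith [Real.pi_pos]
    have h2 : (-1 : ℝ) < n := by nlinarith [Real.pi_pos]
    have h1' : n < 1 := by exact_mod_cast h1
    have h2' : -1 < n := by exact_mod_cast h2
    omega
  rw [hn0] at hn
  by_contra hne'
  have hsub : a - b ≠ 0 := sub_ne_zero.2 hne'
  have him_pos : ∀ t ∈ Icc (0 : ℝ) 1, 0 < (b + t * (a - b)).im := by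
    rintro t ⟨h0, h1⟩
    have : (b + t * (a - b)).im = (1 - t) * b.im + t * a.im := by
      simp; ring
    rw [this]
    rcases h0.eq_or_lt with rfl | h0
    · simpa using hb0
    · have := mul_pos h0 ha0
      have := mul_nonneg (sub_nonneg.2 h1) hb0.le
      linarith
  have hd : ∀ t ∈ Icc (0 : ℝ) 1, HasDerivAt
      (fun t : ℝ => ((Complex.log (b + t * (a - b)) + (b + t * (a - b))) / (a - b)).im)
      (((b + t * (a - b))⁻¹ + 1 : ℂ).im) t := by
    intro t ht
    have h1 : HasDerivAt (fun t : ℝ => b + t * (a - b)) (a - b) t := by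
      simpa using (((hasDerivAt_id t).ofReal_comp).mul_const (a - b)).const_add b
    have h2 := ((h1.clog_real (Complex.mem_slitPlane_iff.2
      (Or.inr (him_pos t ht).ne'))).add h1).div_const (a - b)
    refine (Complex.imCLM.hasFDerivAt.comp_hasDerivAt t h2).congr_deriv ?_
    rw [Complex.imCLM_apply]
    congr 1
    have := hne (him_pos t ht)
    field_simp
  obtain ⟨t, ht, h0⟩ := exists_hasDerivAt_eq_zero zero_lt_one
    (fun t ht => (hd t ht).continuousAt.continuousWithinAt)
    (by simp [hn]) (fun t ht => hd t (Ioo_subset_Icc_self ht))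
  have hp := him_pos t (Ioo_subset_Icc_self ht)
  rw [Complex.add_im, Complex.inv_im, Complex.one_im, add_zero, div_eq_zero_iff] at h0
  rcases h0 with h0 | h0
  · linarith
  · exact hne hp (Complex.normSq_eq_zero.1 h0)

/-! ### The boundary curve, the cut and the weight -/

/-- The boundary curve `v ↦ -v cot v + iv` of the range of the principal branch of the Lambert
function, continued analytically to complex parameters and across `v = 0`. -/
noncomputable def lambertCurve (v : ℂ) : ℂ :=
  -(Complex.cos v / dslope Complex.sin 0 v) + v * Complex.I

theorem differentiable_dslope_sin : Differentiable ℂ (dslope Complex.sin 0) :=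
  differentiableOn_univ.1
    ((Complex.differentiableOn_dslope univ_mem).2 Complex.differentiable_sin.differentiableOn)

theorem dslope_sin_ofReal {v : ℝ} (hv : v ≠ 0) :
    dslope Complex.sin 0 (v : ℂ) = (Real.sin v / v : ℝ) := by
  rw [dslope_of_ne _ (by simpa using hv), slope_def_field]
  simp

theorem Real.sin_ne_zero_of_abs_lt_pi {v : ℝ} (hv : v ∈ Ioo (-Real.pi) Real.pi) (h0 : v ≠ 0) :
    Real.sin v ≠ 0 := by
  rcases lt_or_gt_of_ne h0 with h | h
  · exact (Real.sin_neg_of_neg_of_neg_pi_lt h hv.1).ne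
  · exact (Real.sin_pos_of_pos_of_lt_pi h hv.2).ne'

theorem dslope_sin_ne_zero {v : ℝ} (hv : v ∈ Ioo (-Real.pi) Real.pi) :
    dslope Complex.sin 0 (v : ℂ) ≠ 0 := by
  by_cases h0 : v = 0
  · simp [h0]
  · rw [dslope_sin_ofReal h0]
    have := Real.sin_ne_zero_of_abs_lt_pi hv h0
    exact_mod_cast div_ne_zero this h0

theorem analyticAt_lambertCurve {v : ℝ} (hv : v ∈ Ioo (-Real.pi) Real.pi) :
    AnalyticAt ℂ lambertCurve v :=
  ((Complex.analyticAt_cos.div (differentiable_dslope_sin.analyticAt _)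
    (dslope_sin_ne_zero hv)).neg).add (analyticAt_id.mul analyticAt_const)

theorem lambertCurve_ofReal {v : ℝ} (hv : v ≠ 0) :
    lambertCurve v = (-(v * Real.cot v) : ℝ) + v * Complex.I := by
  rw [lambertCurve, dslope_sin_ofReal hv, Real.cot_eq_cos_div_sin]
  push_cast
  congr 2
  rw [div_div_eq_mul_div]
  ring

theorem lambertCurve_zero : lambertCurve 0 = -1 := by
  simp [lambertCurve]

theorem lambertCurve_im (v : ℝ) : (lambertCurve v).im = v := by
  by_cases h : v = 0
  · simp [h, lambertCurve_zero]
  · rw [lambertCurve_ofReal h, Complex.add_im, Complex.ofReal_im, Complex.im_ofReal_mul]; simp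

theorem lambertCurve_re {v : ℝ} (hv : v ≠ 0) : (lambertCurve v).re = -(v * Real.cot v) := by
  rw [lambertCurve_ofReal hv, Complex.add_re, Complex.ofReal_re, Complex.re_ofReal_mul]; simp

theorem lambertCurve_neg (v : ℝ) : lambertCurve (-v : ℝ) = conj (lambertCurve v) := by
  by_cases h : v = 0
  · simp [h, lambertCurve_zero]
  · rw [lambertCurve_ofReal h, lambertCurve_ofReal (neg_ne_zero.2 h), Real.cot_eq_cos_div_sin,
      Real.cot_eq_cos_div_sin, map_add, map_mul, Complex.conj_ofReal, Complex.conj_ofReal,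
      Complex.conj_I, Real.cos_neg, Real.sin_neg]
    push_cast
    ring

/-- The modulus of `w * exp w` on the boundary curve. -/
noncomputable def lambertCut (v : ℝ) : ℝ :=
  v * (1 / Real.sin v) * Real.exp (-(v * Real.cot v))

/-- The weight of the integral representation. -/
noncomputable def lambertWeight (v : ℝ) : ℝ :=
  v ^ 2 + (1 - v * Real.cot v) ^ 2

theorem lambertCut_neg (v : ℝ) : lambertCut (-v) = lambertCut v := by
  simp [lambertCut, Real.cot_eq_cos_div_sin, div_neg]

theorem lambertCut_pos_of_pos {v : ℝ} (hv : v ∈ Ioo 0 Real.pi) : 0 < lambertCut v := by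
  have h1 := Real.sin_pos_of_pos_of_lt_pi hv.1 hv.2
  have h2 := hv.1
  unfold lambertCut
  positivity

/-- The curve is `-(v / sin v) e^{-iv}`, and the phase `e^{-iv}` cancels that of its exponential. -/
theorem lambertCurve_mul_exp {v : ℝ} (hv : v ∈ Ioo (-Real.pi) Real.pi) (h0 : v ≠ 0) :
    lambertCurve v * Complex.exp (lambertCurve v) = -(lambertCut v : ℂ) := by
  have hs := Real.sin_ne_zero_of_abs_lt_pi hv h0
  have h1 : lambertCurve v = -((v / Real.sin v : ℝ) : ℂ) * Complex.exp (-(v * Complex.I)) := by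
    have hs' : Complex.sin v ≠ 0 := by exact_mod_cast hs
    rw [lambertCurve_ofReal h0, Real.cot_eq_cos_div_sin, ← neg_mul (v : ℂ) Complex.I,
      Complex.exp_mul_I]
    push_cast
    rw [Complex.cos_neg, Complex.sin_neg]
    field_simp
    ring
  nth_rewrite 1 [h1]
  rw [lambertCurve_ofReal h0, Complex.exp_add, lambertCut, Complex.exp_neg (v * Complex.I)]
  have := Complex.exp_ne_zero (v * Complex.I)
  push_cast
  field_simp

theorem exists_lambertCurve_mul_exp {v : ℝ} (hv : v ∈ Ioo (-Real.pi) Real.pi) :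
    ∃ t : ℝ, 0 < t ∧ lambertCurve v * Complex.exp (lambertCurve v) = -(t : ℂ) := by
  by_cases h0 : v = 0
  · exact ⟨Real.exp (-1), Real.exp_pos _, by simp [h0, lambertCurve_zero]⟩
  · refine ⟨lambertCut v, ?_, lambertCurve_mul_exp hv h0⟩
    rcases lt_or_gt_of_ne h0 with h | h
    · rw [← lambertCut_neg]
      exact lambertCut_pos_of_pos ⟨by linarith, by linarith [hv.1]⟩
    · exact lambertCut_pos_of_pos ⟨h, hv.2⟩

theorem Real.mul_cot_le_one {v : ℝ} (hv : v ∈ Ioo 0 Real.pi) : v * Real.cot v ≤ 1 := by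
  have hs := Real.sin_pos_of_pos_of_lt_pi hv.1 hv.2
  rw [Real.cot_eq_cos_div_sin, ← mul_div_assoc, div_le_one hs]
  rcases lt_or_ge v (Real.pi / 2) with h | h
  · have hc := Real.cos_pos_of_mem_Ioo ⟨by linarith [hv.1, Real.pi_pos], h⟩
    have := Real.le_tan hv.1.le h
    rwa [Real.tan_eq_sin_div_cos, le_div_iff₀ hc] at this
  · have hc := Real.cos_nonpos_of_pi_div_two_le_of_le h (by linarith [hv.2, Real.pi_pos])
    have := mul_nonpos_of_nonneg_of_nonpos hv.1.le hc
    linarith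

theorem neg_one_le_lambertCurve_re {v : ℝ} (hv : v ∈ Ioo (-Real.pi) Real.pi) :
    -1 ≤ (lambertCurve v).re := by
  rcases lt_trichotomy v 0 with h | rfl | h
  · have := Real.mul_cot_le_one (v := -v) ⟨by linarith, by linarith [hv.1]⟩
    have h2 := congrArg Complex.re (lambertCurve_neg v)
    rw [lambertCurve_re (by linarith)] at h2
    simp only [Complex.conj_re] at h2
    linarith
  · simp [lambertCurve_zero]
  · have := Real.mul_cot_le_one ⟨h, hv.2⟩
    rw [lambertCurve_re h.ne']
    linarith

/-! ### The region right of the curve, and injectivity there -/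

/-- The closure of the range of the principal branch. -/
def lambertRegion : Set ℂ :=
  {ζ | ∃ s : ℝ, 0 ≤ s ∧ ∃ v ∈ Ioo (-Real.pi) Real.pi, ζ = s + lambertCurve v}

theorem lambertWRange_subset_lambertRegion : lambertWRange ⊆ lambertRegion := by
  intro w hw
  have hπ := Real.pi_pos
  have key : w.im ∈ Ioo (-Real.pi) Real.pi ∧ (lambertCurve w.im).re ≤ w.re := by
    rcases hw with ⟨h1, h2⟩ | ⟨h1, h2, h3⟩ | ⟨h1, h2, h3⟩
    · refine ⟨⟨by linarith, by linarith⟩, ?_⟩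
      simpa [h1, lambertCurve_zero] using h2
    · exact ⟨⟨by linarith, h2⟩, by rwa [lambertCurve_re h1.ne']⟩
    · exact ⟨⟨h1, by linarith⟩, by rw [lambertCurve_re h2.ne]; exact h3.le⟩
  refine ⟨w.re - (lambertCurve w.im).re, sub_nonneg.2 key.2, w.im, key.1, ?_⟩
  apply Complex.ext <;> simp [lambertCurve_im]

theorem conj_mem_lambertRegion {ζ : ℂ} (h : ζ ∈ lambertRegion) : conj ζ ∈ lambertRegion := by
  obtain ⟨s, hs, v, hv, rfl⟩ := h
  refine ⟨s, hs, -v, ⟨by linarith [hv.2], by linarith [hv.1]⟩, ?_⟩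
  rw [lambertCurve_neg, map_add, Complex.conj_ofReal]

theorem Complex.conj_mul_exp (ζ : ℂ) :
    conj ζ * Complex.exp (conj ζ) = conj (ζ * Complex.exp ζ) := by
  rw [map_mul, Complex.exp_conj]

theorem neg_ofReal_notMem_slitPlane {t : ℝ} (ht : 0 ≤ t) : -(t : ℂ) ∉ Complex.slitPlane := by
  rw [Complex.mem_slitPlane_iff]
  simp [ht]

/-- The shape of `ζ * exp ζ` on the region. -/
theorem lambertRegion_mul_exp {ζ : ℂ} (h : ζ ∈ lambertRegion)
    (hz : ζ * Complex.exp ζ ∈ Complex.slitPlane) :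
    ∃ k : ℝ, 0 < k ∧ (ζ * Complex.exp ζ).im = k * Real.sin ζ.im := by
  obtain ⟨s, hs, v, hv, rfl⟩ := h
  obtain ⟨t, ht, he⟩ := exists_lambertCurve_mul_exp hv
  -- Since `γ * exp γ = -t` is real, only the term `s * exp γ` contributes to the imaginary part,
  -- and `γ` has height `v`.
  have h1 : (s + lambertCurve v) * Complex.exp (s + lambertCurve v) =
      (Real.exp s : ℝ) * ((s : ℝ) * Complex.exp (lambertCurve v) + ((-t : ℝ) : ℂ)) := by
    rw [Complex.exp_add]
    push_cast
    linear_combination Complex.exp s * he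
  rcases hs.eq_or_lt with rfl | hs
  · rw [Complex.ofReal_zero, zero_add, he] at hz
    exact absurd hz (neg_ofReal_notMem_slitPlane ht.le)
  · refine ⟨Real.exp s * (s * Real.exp (lambertCurve v).re), by positivity, ?_⟩
    rw [h1, Complex.im_ofReal_mul, Complex.add_im, Complex.im_ofReal_mul, Complex.exp_im,
      Complex.ofReal_im, Complex.add_im, Complex.ofReal_im, zero_add, add_zero]
    ring

theorem lambertRegion_im_mem {ζ : ℂ} (h : ζ ∈ lambertRegion) : ζ.im ∈ Ioo (-Real.pi) Real.pi := by
  obtain ⟨s, hs, v, hv, rfl⟩ := h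
  simpa [lambertCurve_im] using hv

theorem im_pos_of_im_mul_exp_pos {ζ : ℂ} (h : ζ ∈ lambertRegion)
    (hz : 0 < (ζ * Complex.exp ζ).im) : 0 < ζ.im := by
  obtain ⟨k, hk, he⟩ := lambertRegion_mul_exp h (Complex.mem_slitPlane_iff.2 (Or.inr hz.ne'))
  have hζ := lambertRegion_im_mem h
  by_contra hn
  have := Real.sin_nonpos_of_nonpos_of_neg_pi_le (not_lt.1 hn) hζ.1.le
  nlinarith

theorem eq_of_mul_exp_eq_of_im_pos {a b : ℂ} (ha : a ∈ lambertRegion) (hb : b ∈ lambertRegion)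
    (hz : 0 < (a * Complex.exp a).im) (hab : a * Complex.exp a = b * Complex.exp b) : a = b :=
  Complex.injOn_mul_exp_strip
    ⟨im_pos_of_im_mul_exp_pos ha hz, (lambertRegion_im_mem ha).2⟩
    ⟨im_pos_of_im_mul_exp_pos hb (hab ▸ hz), (lambertRegion_im_mem hb).2⟩ hab

theorem eq_ofReal_of_im_mul_exp_eq_zero {ζ : ℂ} (h : ζ ∈ lambertRegion)
    (hz : ζ * Complex.exp ζ ∈ Complex.slitPlane) (h0 : (ζ * Complex.exp ζ).im = 0) :
    ∃ x : ℝ, 0 < x ∧ ζ = x := by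
  obtain ⟨k, hk, he⟩ := lambertRegion_mul_exp h hz
  rw [h0] at he
  have hs : Real.sin ζ.im = 0 := by
    rcases mul_eq_zero.1 he.symm with h | h
    · exact absurd h hk.ne'
    · exact h
  have hi : ζ.im = 0 := by
    by_contra hne
    exact Real.sin_ne_zero_of_abs_lt_pi (lambertRegion_im_mem h) hne hs
  have hx : ζ = (ζ.re : ℂ) := by apply Complex.ext <;> simp [hi]
  refine ⟨ζ.re, ?_, hx⟩
  by_contra hn
  rw [hx, ← Complex.ofReal_exp, ← Complex.ofReal_mul, Complex.ofReal_mem_slitPlane] at hz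
  have := Real.exp_pos ζ.re
  nlinarith

/-- `ζ ↦ ζ * exp ζ` takes each value off the negative axis at most once on the region. -/
theorem eq_of_mul_exp_eq {a b : ℂ} (ha : a ∈ lambertRegion) (hb : b ∈ lambertRegion)
    (hz : a * Complex.exp a ∈ Complex.slitPlane)
    (hab : a * Complex.exp a = b * Complex.exp b) : a = b := by
  -- Conjugation reduces the lower half-plane to the upper one. For real values both preimages are
  -- positive reals, where `x * exp x` is strictly increasing.
  rcases lt_trichotomy (a * Complex.exp a).im 0 with h | h | h
  · have := eq_of_mul_exp_eq_of_im_pos (conj_mem_lambertRegion ha) (conj_mem_lambertRegion hb)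
      (by rw [Complex.conj_mul_exp, Complex.conj_im]; linarith)
      (by rw [Complex.conj_mul_exp, Complex.conj_mul_exp, hab])
    exact (starRingEnd ℂ).injective this
  · obtain ⟨x, hx, rfl⟩ := eq_ofReal_of_im_mul_exp_eq_zero ha hz h
    obtain ⟨y, hy, rfl⟩ := eq_ofReal_of_im_mul_exp_eq_zero hb (hab ▸ hz) (hab ▸ h)
    have h1 : x * Real.exp x = y * Real.exp y := by exact_mod_cast hab
    have h2 : StrictMonoOn (fun x : ℝ => x * Real.exp x) (Ioi 0) := fun x hx y hy hxy =>
      mul_lt_mul'' hxy (Real.exp_lt_exp.2 hxy) (le_of_lt hx) (Real.exp_pos _).le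
    exact congrArg _ (h2.injOn hx hy h1)
  · exact eq_of_mul_exp_eq_of_im_pos ha hb h hab

/-! ### Existence of preimages; the branch `W` -/

/-- Seek `w` of height `v` and argument `θ - v`, where `θ = arg z`. Then `w * exp w` has argument
`θ` automatically, and only its modulus `g v` remains to be matched with `‖z‖`, by the intermediate
value theorem. -/
theorem exists_mul_exp_eq_of_im_pos {z : ℂ} (hz : 0 < z.im) :
    ∃ w : ℂ, 0 < w.im ∧ w.im < Real.pi ∧ -(w.im * Real.cot w.im) < w.re ∧
      w * Complex.exp w = z := by
  set θ := z.arg with hθ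
  have hz0 : z ≠ 0 := fun h => by simp [h] at hz
  have hr : 0 < ‖z‖ := norm_pos_iff.2 hz0
  have hzeq : (‖z‖ : ℂ) * Complex.exp (θ * Complex.I) = z := Complex.norm_mul_exp_arg_mul_I z
  have hθπ : θ < Real.pi := Complex.arg_lt_pi_iff.2 (Or.inr hz.ne')
  have hθ0 : 0 < θ := by
    refine (Complex.arg_nonneg_iff.2 hz.le).lt_of_ne' fun h => ?_
    rw [Complex.arg_eq_zero_iff] at h
    linarith [h.2]
  set g : ℝ → ℝ := fun v =>
    v / Real.sin (θ - v) * Real.exp (v * (Real.cos (θ - v) / Real.sin (θ - v))) with hg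
  have hsin : ∀ v, 0 ≤ v → v < θ → 0 < Real.sin (θ - v) := fun v h0 h1 =>
    Real.sin_pos_of_pos_of_lt_pi (by linarith) (by linarith)
  -- Near `v = θ` the function `g` blows up. The first bound gives `θ - ε ≥ θ / 2` and `cos ε ≥ 0`;
  -- the second then gives `(θ - ε) / sin ε ≥ θ / (2ε) ≥ ‖z‖`.
  set ε := min (θ / 2) (θ / (2 * ‖z‖)) with hε
  have hε0 : 0 < ε := lt_min (by linarith) (by positivity)
  have hεθ : ε ≤ θ / 2 := min_le_left _ _
  have hcont : ContinuousOn g (Icc 0 (θ - ε)) := by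
    have h1 : ∀ v ∈ Icc 0 (θ - ε), Real.sin (θ - v) ≠ 0 := fun v hv =>
      (hsin v hv.1 (by linarith [hv.2])).ne'
    have h2 : Continuous fun v : ℝ => Real.sin (θ - v) := by fun_prop
    have h3 : Continuous fun v : ℝ => Real.cos (θ - v) := by fun_prop
    exact (continuousOn_id.div h2.continuousOn h1).mul
      (continuousOn_id.mul (h3.continuousOn.div h2.continuousOn h1)).rexp
  have hend : ‖z‖ ≤ g (θ - ε) := by
    have hs := hsin (θ - ε) (by linarith) (by linarith)
    simp only [hg, sub_sub_cancel] at hs ⊢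
    have hc : 0 ≤ Real.cos ε := Real.cos_nonneg_of_mem_Icc ⟨by linarith, by linarith⟩
    have hse : Real.sin ε ≤ ε := Real.sin_le hε0.le
    have h1 : ‖z‖ ≤ (θ - ε) / Real.sin ε := by
      rw [le_div_iff₀ hs]
      have h2 : ε ≤ θ / (2 * ‖z‖) := min_le_right _ _
      rw [le_div_iff₀ (by positivity)] at h2
      nlinarith
    have h2 : 1 ≤ Real.exp ((θ - ε) * (Real.cos ε / Real.sin ε)) :=
      Real.one_le_exp (mul_nonneg (by linarith) (div_nonneg hc hs.le))
    calc ‖z‖ ≤ (θ - ε) / Real.sin ε := h1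
      _ ≤ _ := le_mul_of_one_le_right (hr.le.trans h1) h2
  obtain ⟨v, hv, hgv⟩ := intermediate_value_Icc (by linarith : 0 ≤ θ - ε) hcont
    (show ‖z‖ ∈ Icc (g 0) (g (θ - ε)) from ⟨by simp [hg], hend⟩)
  have hv0 : 0 < v := by
    refine hv.1.lt_of_ne fun h => ?_
    rw [← h] at hgv
    simp [hg] at hgv
    exact hr.ne' hgv.symm
  have hvθ : v < θ := by linarith [hv.2]
  have hs := hsin v hv0.le hvθ
  have hsv : 0 < Real.sin v := Real.sin_pos_of_pos_of_lt_pi hv0 (by linarith)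
  obtain ⟨u, hu⟩ : ∃ u, u = v * (Real.cos (θ - v) / Real.sin (θ - v)) := ⟨_, rfl⟩
  refine ⟨⟨u, v⟩, hv0, hvθ.trans hθπ, ?_, ?_⟩
  · have h1 : 0 < Real.sin θ := Real.sin_pos_of_pos_of_lt_pi hθ0 hθπ
    have h2 : Real.sin θ = Real.sin (θ - v) * Real.cos v + Real.cos (θ - v) * Real.sin v := by
      rw [← Real.sin_add, sub_add_cancel]
    -- The identity `cot (θ - v) + cot v = sin θ / (sin (θ - v) sin v)` puts `w` strictly to the
    -- right of the curve.
    have h3 : u + v * Real.cot v = v * Real.sin θ / (Real.sin (θ - v) * Real.sin v) := by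
      rw [hu, Real.cot_eq_cos_div_sin, h2]
      field_simp
      ring
    have h4 : 0 < v * Real.sin θ / (Real.sin (θ - v) * Real.sin v) := by positivity
    simp only
    linarith
  · have h1 : (⟨u, v⟩ : ℂ) = ((v / Real.sin (θ - v) : ℝ) : ℂ) *
        Complex.exp (((θ - v : ℝ) : ℂ) * Complex.I) := by
      apply Complex.ext
      · rw [Complex.re_ofReal_mul, Complex.exp_ofReal_mul_I_re, hu]; ring
      · rw [Complex.im_ofReal_mul, Complex.exp_ofReal_mul_I_im]
        simp only
        field_simp
    have h2 : (⟨u, v⟩ : ℂ) = u + v * Complex.I := (Complex.re_add_im ⟨u, v⟩).symm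
    nth_rewrite 1 [h1]
    have h5 : ‖z‖ = v / Real.sin (θ - v) * Real.exp u := by rw [hu, ← hgv]
    have h3 : Complex.exp (θ * Complex.I) =
        Complex.exp (((θ - v : ℝ) : ℂ) * Complex.I) * Complex.exp (v * Complex.I) := by
      rw [← Complex.exp_add]; congr 1; push_cast; ring
    rw [h2, Complex.exp_add, ← hzeq, h5, Complex.ofReal_mul, Complex.ofReal_exp, h3]; ring

theorem exists_mem_lambertWRange {z : ℂ} (hz : z ∈ Complex.slitPlane) :
    ∃ w ∈ lambertWRange, w * Complex.exp w = z := by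
  rcases lt_trichotomy z.im 0 with h | h | h
  · obtain ⟨w, h1, h2, h3, h4⟩ := exists_mul_exp_eq_of_im_pos (z := conj z) (by simpa using h)
    refine ⟨conj w, Or.inr (Or.inr ⟨?_, ?_, ?_⟩), ?_⟩
    · simpa using h2
    · simpa using h1
    · simpa [Real.cot_eq_cos_div_sin, div_neg] using h3
    · rw [Complex.conj_mul_exp, h4, Complex.conj_conj]
  · have hx : z = (z.re : ℂ) := by apply Complex.ext <;> simp [h]
    rw [hx, Complex.ofReal_mem_slitPlane] at hz
    have hc : ContinuousOn (fun x : ℝ => x * Real.exp x) (Icc 0 z.re) := by fun_prop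
    obtain ⟨x, hx1, hx2⟩ := intermediate_value_Icc hz.le hc
      (show z.re ∈ Icc _ _ from ⟨by simpa using hz.le,
        le_mul_of_one_le_right hz.le (Real.one_le_exp hz.le)⟩)
    refine ⟨x, Or.inl ⟨by simp, by simp only [Complex.ofReal_re]; linarith [hx1.1]⟩, ?_⟩
    rw [hx, ← hx2]
    push_cast
    rfl
  · obtain ⟨w, h1, h2, h3, h4⟩ := exists_mul_exp_eq_of_im_pos h
    exact ⟨w, Or.inr (Or.inl ⟨h1, h2, h3.le⟩), h4⟩

theorem lambertW_mem_lambertRegion {z : ℂ} (hz : z ∈ Complex.slitPlane) :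
    lambertW z ∈ lambertRegion :=
  lambertWRange_subset_lambertRegion (Function.invFunOn_mem (exists_mem_lambertWRange hz))

theorem lambertW_mul_exp {z : ℂ} (hz : z ∈ Complex.slitPlane) :
    lambertW z * Complex.exp (lambertW z) = z :=
  Function.invFunOn_eq (f := fun w : ℂ => w * Complex.exp w) (exists_mem_lambertWRange hz)

/-! ### The pole at `w` and decay to the right -/

theorem hasDerivAt_mul_exp (w : ℂ) :
    HasDerivAt (fun ζ : ℂ => ζ * Complex.exp ζ) ((1 + w) * Complex.exp w) w :=
  ((hasDerivAt_id w).mul (Complex.hasDerivAt_exp w)).congr_deriv (by simp; ring)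

theorem one_add_ne_zero_of_mul_exp_mem_slitPlane {w : ℂ}
    (hz : w * Complex.exp w ∈ Complex.slitPlane) : 1 + w ≠ 0 := by
  intro h
  obtain rfl : w = -1 := by linear_combination h
  have h1 : (-1 : ℂ) * Complex.exp (-1) = -((Real.exp (-1) : ℝ) : ℂ) := by push_cast; ring
  rw [h1] at hz
  exact neg_ofReal_notMem_slitPlane (Real.exp_pos _).le hz

/-- Removing the pole of `(1 + ζ) / (ζ * exp ζ - z)` in the region. -/
theorem exists_regular_part {w : ℂ} (hw : w ∈ lambertRegion)
    (hz : w * Complex.exp w ∈ Complex.slitPlane) :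
    ∃ G : ℂ → ℂ, (∀ ζ ∈ lambertRegion, DifferentiableAt ℂ G ζ) ∧ ∀ ζ ∈ lambertRegion, ζ ≠ w →
      G ζ = (1 + ζ) / (ζ * Complex.exp ζ - w * Complex.exp w) - Complex.exp (-w) / (ζ - w) := by
  set φ : ℂ → ℂ := fun ζ => ζ * Complex.exp ζ with hφ
  set h : ℂ → ℂ := dslope φ w with hh
  have hφd : Differentiable ℂ φ := fun ζ => (hasDerivAt_mul_exp ζ).differentiableAt
  have hhd : Differentiable ℂ h := differentiableOn_univ.1
    ((Complex.differentiableOn_dslope univ_mem).2 hφd.differentiableOn)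
  have hhw : h w = (1 + w) * Complex.exp w := by
    rw [hh, dslope_same, (hasDerivAt_mul_exp w).deriv]
  have hhne : ∀ ζ, ζ ≠ w → h ζ = (φ ζ - φ w) / (ζ - w) := fun ζ hζ => by
    rw [hh, dslope_of_ne _ hζ, slope_def_field]
  have hφne : ∀ ζ ∈ lambertRegion, ζ ≠ w → φ ζ - φ w ≠ 0 := fun ζ hζ hne h0 =>
    hne (eq_of_mul_exp_eq hw hζ hz (sub_eq_zero.1 h0).symm).symm
  have h1w := one_add_ne_zero_of_mul_exp_mem_slitPlane hz
  have hh0w : h w ≠ 0 := by rw [hhw]; exact mul_ne_zero h1w (Complex.exp_ne_zero w)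
  have hh0 : ∀ ζ ∈ lambertRegion, h ζ ≠ 0 := fun ζ hζ => by
    by_cases hne : ζ = w
    · rwa [hne]
    · rw [hhne ζ hne]
      exact div_ne_zero (hφne ζ hζ hne) (sub_ne_zero.2 hne)
  have hopen : IsOpen {ζ | h ζ ≠ 0} := isOpen_ne_fun hhd.continuous continuous_const
  -- Off `w` the function to regularise is `q ζ / (ζ - w)`, with `q` holomorphic near the region and
  -- `q w = exp (-w)`; the regular part is therefore `dslope q w`.
  set q : ℂ → ℂ := fun ζ => (1 + ζ) / h ζ with hq
  have hqd : DifferentiableOn ℂ q {ζ | h ζ ≠ 0} := fun ζ hζ =>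
    (((differentiableAt_const _).add differentiableAt_id).div (hhd ζ) hζ).differentiableWithinAt
  refine ⟨dslope q w, fun ζ hζ =>
    ((Complex.differentiableOn_dslope (hopen.mem_nhds hh0w)).2 hqd).differentiableAt
      (hopen.mem_nhds (hh0 ζ hζ)), fun ζ hζ hne => ?_⟩
  have h2 := hφne ζ hζ hne
  have h3 := sub_ne_zero.2 hne
  have h4 := Complex.exp_ne_zero w
  have hqw : q w = Complex.exp (-w) := by
    simp only [hq, hhw]
    rw [Complex.exp_neg]
    field_simp
  rw [dslope_of_ne _ hne, slope_def_field, hqw]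
  simp only [hq, hhne ζ hne]
  simp only [hφ] at h2 ⊢
  field_simp

theorem norm_one_add_div_mul_exp_sub_le {z ζ : ℂ} (h1 : 1 ≤ ζ.re) (h2 : 2 * ‖z‖ ≤ ζ.re) :
    ‖(1 + ζ) / (ζ * Complex.exp ζ - z)‖ ≤ 8 / ζ.re ^ 2 := by
  set u := ζ.re with hu
  have hζ : u ≤ ‖ζ‖ := Complex.re_le_norm ζ
  have hexp : u ^ 2 / 2 ≤ Real.exp u := by
    have := Real.quadratic_le_exp_of_nonneg (x := u) (by linarith)
    linarith
  have hexp1 : 1 ≤ Real.exp u := Real.one_le_exp (by linarith)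
  have hnum : ‖1 + ζ‖ ≤ 2 * ‖ζ‖ := by
    refine (norm_add_le _ _).trans ?_
    rw [norm_one]; linarith
  have hden : ‖ζ‖ * Real.exp u / 2 ≤ ‖ζ * Complex.exp ζ - z‖ := by
    have h3 := norm_sub_norm_le (ζ * Complex.exp ζ) z
    rw [norm_mul, Complex.norm_exp] at h3
    have h4 : ‖ζ‖ ≤ ‖ζ‖ * Real.exp u := le_mul_of_one_le_right (norm_nonneg _) hexp1
    linarith
  have hpos : 0 < ‖ζ‖ := by linarith
  have hu0 : 0 < u := by linarith
  rw [norm_div]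
  calc ‖1 + ζ‖ / ‖ζ * Complex.exp ζ - z‖ ≤ (2 * ‖ζ‖) / (‖ζ‖ * Real.exp u / 2) := by gcongr
    _ = 4 / Real.exp u := by field_simp; ring
    _ ≤ 4 / (u ^ 2 / 2) := by gcongr
    _ = 8 / u ^ 2 := by field_simp; ring

/-! ### The polar term along the curve -/

theorem hasDerivAt_lambertCurve {v : ℝ} (hv : v ∈ Ioo (-Real.pi) Real.pi) :
    HasDerivAt (fun v : ℝ => lambertCurve v) (deriv lambertCurve v) v :=
  (analyticAt_lambertCurve hv).differentiableAt.hasDerivAt.comp_ofReal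

theorem hasDerivAt_deriv_lambertCurve {v : ℝ} (hv : v ∈ Ioo (-Real.pi) Real.pi) :
    HasDerivAt (fun v : ℝ => deriv lambertCurve v) (deriv (deriv lambertCurve) v) v :=
  (analyticAt_lambertCurve hv).deriv.differentiableAt.hasDerivAt.comp_ofReal

theorem Icc_neg_subset_Ioo_pi {b : ℝ} (hb : b < Real.pi) :
    Icc (-b) b ⊆ Ioo (-Real.pi) Real.pi :=
  fun v hv => ⟨by linarith [hv.1], by linarith [hv.2]⟩

theorem add_lambertCurve_mem_lambertRegion {s v : ℝ} (hs : 0 ≤ s)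
    (hv : v ∈ Ioo (-Real.pi) Real.pi) : s + lambertCurve v ∈ lambertRegion :=
  ⟨s, hs, v, hv, rfl⟩

theorem lambertCurve_mem_lambertRegion {v : ℝ} (hv : v ∈ Ioo (-Real.pi) Real.pi) :
    lambertCurve v ∈ lambertRegion := by
  simpa using add_lambertCurve_mem_lambertRegion le_rfl hv

/-- The difference is real only when both points have the same height, and then `w` lies strictly to
the right of the curve. This makes `log (w - γ)` a primitive along the whole curve. -/
theorem sub_lambertCurve_mem_slitPlane {w : ℂ} (hw : w ∈ lambertRegion)
    (hz : w * Complex.exp w ∈ Complex.slitPlane) {v : ℝ} (hv : v ∈ Ioo (-Real.pi) Real.pi) :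
    w - lambertCurve v ∈ Complex.slitPlane := by
  obtain ⟨s, hs, v₀, hv₀, rfl⟩ := hw
  rw [Complex.mem_slitPlane_iff]
  by_cases h : v = v₀
  · left
    subst h
    simp only [add_sub_cancel_right, Complex.ofReal_re]
    refine hs.lt_of_ne fun h0 => ?_
    obtain ⟨t, ht, he⟩ := exists_lambertCurve_mul_exp hv
    rw [← h0, Complex.ofReal_zero, zero_add, he] at hz
    exact neg_ofReal_notMem_slitPlane ht.le hz
  · right
    simpa [lambertCurve_im, sub_eq_zero] using Ne.symm h

theorem integral_lambertCurve_inv_sub {w : ℂ} (hw : w ∈ lambertRegion)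
    (hz : w * Complex.exp w ∈ Complex.slitPlane) {b : ℝ} (hb0 : 0 ≤ b) (hb : b < Real.pi) :
    ∫ v in -b..b, (lambertCurve v - w)⁻¹ * deriv lambertCurve v =
      Complex.log (w - lambertCurve b) - Complex.log (w - lambertCurve (-b : ℝ)) := by
  have hsub : ∀ v ∈ uIcc (-b) b, v ∈ Ioo (-Real.pi) Real.pi := by
    rw [uIcc_of_le (by linarith)]
    exact Icc_neg_subset_Ioo_pi hb
  have hne : ∀ v ∈ uIcc (-b) b, w - lambertCurve v ≠ 0 := fun v hv =>
    Complex.slitPlane_ne_zero (sub_lambertCurve_mem_slitPlane hw hz (hsub v hv))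
  refine intervalIntegral.integral_eq_sub_of_hasDerivAt
    (f := fun v : ℝ => Complex.log (w - lambertCurve v)) (fun v hv => ?_)
    (ContinuousOn.intervalIntegrable fun v hv => ContinuousAt.continuousWithinAt ?_)
  · refine (((hasDerivAt_lambertCurve (hsub v hv)).const_sub w).clog_real
      (sub_lambertCurve_mem_slitPlane hw hz (hsub v hv))).congr_deriv ?_
    rw [← neg_sub w, inv_neg]
    field_simp
  · refine (((hasDerivAt_lambertCurve (hsub v hv)).continuousAt.sub continuousAt_const).inv₀
      ?_).mul (hasDerivAt_deriv_lambertCurve (hsub v hv)).continuousAt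
    exact sub_ne_zero.2 (sub_ne_zero.1 (hne v hv)).symm

theorem Complex.log_neg_of_im_pos {a : ℂ} (h : 0 < a.im) :
    Complex.log (-a) = Complex.log a - Real.pi * Complex.I := by
  rw [Complex.log, Complex.log, norm_neg, Complex.arg_neg_eq_arg_sub_pi_of_im_pos h]
  push_cast; ring

theorem Complex.log_neg_of_im_neg {a : ℂ} (h : a.im < 0) :
    Complex.log (-a) = Complex.log a + Real.pi * Complex.I := by
  rw [Complex.log, Complex.log, norm_neg, Complex.arg_neg_eq_arg_add_pi_of_im_neg h]
  push_cast; ring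

theorem Complex.norm_log_sub_log_le {a b : ℂ} {x : ℝ} (hx : 0 < x) (ha : x ≤ a.re)
    (hb : x ≤ b.re) : ‖Complex.log a - Complex.log b‖ ≤ ‖a - b‖ / x := by
  have hconv : Convex ℝ {c : ℂ | x ≤ c.re} := convex_halfSpace_re_ge x
  have := hconv.norm_image_sub_le_of_norm_hasDerivWithin_le (f := Complex.log)
    (f' := fun c => c⁻¹) (C := x⁻¹)
    (fun c hc => (Complex.hasDerivAt_log (Or.inl (hx.trans_le hc))).hasDerivWithinAt)
    (fun c hc => by
      rw [norm_inv]
      exact inv_anti₀ hx (le_trans hc (Complex.re_le_norm c))) hb ha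
  rwa [inv_mul_eq_div] at this

theorem norm_lambertCurve_sub_neg_le {b : ℝ} (hb0 : 0 ≤ b) (hb : b < Real.pi) :
    ‖lambertCurve b - lambertCurve (-b : ℝ)‖ ≤ 2 * Real.pi := by
  rw [lambertCurve_neg, Complex.sub_conj, lambertCurve_im]
  simp only [norm_mul, Complex.norm_I, mul_one, Complex.norm_real, Real.norm_eq_abs,
    abs_of_nonneg hb0, abs_two]
  linarith

/-- The points `γ(±b) - w` lie far to the right, within `2π` of each other, so their logarithms
nearly agree. Changing sign shifts one logarithm by `-πi` and the other by `πi`, which produces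
`-2πi`. -/
theorem norm_log_lambertCurve_add_le {w : ℂ} {b : ℝ} (hb0 : 0 < b)
    (hb : b < Real.pi) (hbw : |w.im| < b) (hx : w.re < (lambertCurve b).re) :
    ‖Complex.log (w - lambertCurve b) - Complex.log (w - lambertCurve (-b : ℝ))
      + 2 * Real.pi * Complex.I‖ ≤ 2 * Real.pi / ((lambertCurve b).re - w.re) := by
  obtain ⟨h1, h2⟩ := abs_lt.1 hbw
  have ha : 0 < (lambertCurve b - w).im := by
    rw [Complex.sub_im, lambertCurve_im]; linarith
  have hc : (lambertCurve (-b : ℝ) - w).im < 0 := by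
    rw [Complex.sub_im, lambertCurve_im]; linarith
  rw [← neg_sub (lambertCurve b), ← neg_sub (lambertCurve (-b : ℝ)),
    Complex.log_neg_of_im_pos ha, Complex.log_neg_of_im_neg hc]
  have h3 := Complex.norm_log_sub_log_le (sub_pos.2 hx) (a := lambertCurve b - w)
    (b := lambertCurve (-b : ℝ) - w) (by simp) (by rw [lambertCurve_neg]; simp)
  have h4 := norm_lambertCurve_sub_neg_le hb0.le hb
  rw [sub_sub_sub_cancel_right] at h3
  calc _ = ‖Complex.log (lambertCurve b - w) - Complex.log (lambertCurve (-b : ℝ) - w)‖ := by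
        congr 1; ring
    _ ≤ _ := h3
    _ ≤ _ := by
      have := sub_pos.2 hx
      gcongr

/-! ### The integrand on the curve -/

theorem hasDerivAt_lambertCurve_of_ne_zero {v : ℝ} (hv : v ∈ Ioo (-Real.pi) Real.pi) (h0 : v ≠ 0) :
    HasDerivAt (fun v : ℝ => lambertCurve v)
      ((-Real.cot v + v / Real.sin v ^ 2 : ℝ) + Complex.I) v := by
  have hs := Real.sin_ne_zero_of_abs_lt_pi hv h0
  have h1 : HasDerivAt (fun v : ℝ => -(v * Real.cot v)) (-Real.cot v + v / Real.sin v ^ 2) v := by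
    simp only [Real.cot_eq_cos_div_sin]
    refine ((hasDerivAt_id v).mul ((Real.hasDerivAt_cos v).div
      (Real.hasDerivAt_sin v) hs)).neg.congr_deriv ?_
    simp only [id, Pi.div_apply]
    field_simp
    linear_combination v * Real.sin_sq_add_cos_sq v
  have h2 := h1.ofReal_comp.add ((hasDerivAt_id v).ofReal_comp.mul_const Complex.I)
  rw [Complex.ofReal_one, one_mul] at h2
  refine h2.congr_of_eventuallyEq ?_
  filter_upwards [isOpen_ne.mem_nhds h0] with u hu
  exact lambertCurve_ofReal hu

theorem deriv_lambertCurve {v : ℝ} (hv : v ∈ Ioo (-Real.pi) Real.pi) (h0 : v ≠ 0) :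
    deriv lambertCurve v = (-Real.cot v + v / Real.sin v ^ 2 : ℝ) + Complex.I :=
  (hasDerivAt_lambertCurve hv).unique (hasDerivAt_lambertCurve_of_ne_zero hv h0)

theorem slitPlane_add_ofReal_ne_zero {z : ℂ} (hz : z ∈ Complex.slitPlane) {t : ℝ} (ht : 0 ≤ t) :
    z + t ≠ 0 := fun h => by
  rw [eq_neg_of_add_eq_zero_left h] at hz
  exact neg_ofReal_notMem_slitPlane ht hz

/-- The contributions of `v` and `-v` to the contour integral add up to the real weight. -/
theorem lambertCurve_integrand_add_neg {z : ℂ} (hz : z ∈ Complex.slitPlane) {v : ℝ}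
    (hv : v ∈ Ioo 0 Real.pi) :
    (1 + lambertCurve v) / (lambertCurve v * Complex.exp (lambertCurve v) - z)
        * deriv lambertCurve v
      + (1 + lambertCurve (-v : ℝ)) /
          (lambertCurve (-v : ℝ) * Complex.exp (lambertCurve (-v : ℝ)) - z)
        * deriv lambertCurve (-v : ℝ)
      = -2 * Complex.I * ((lambertWeight v : ℂ) / (z + lambertCut v)) := by
  have hπ := Real.pi_pos
  have hv' : v ∈ Ioo (-Real.pi) Real.pi := ⟨by linarith [hv.1], hv.2⟩
  have hv'' : -v ∈ Ioo (-Real.pi) Real.pi := ⟨by linarith [hv.2], by linarith [hv.1]⟩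
  have h0 := hv.1.ne'
  have h0' := neg_ne_zero.2 h0
  have hs : Real.sin v ≠ 0 := Real.sin_ne_zero_of_abs_lt_pi hv' h0
  rw [lambertCurve_mul_exp hv' h0, lambertCurve_mul_exp hv'' h0', lambertCut_neg,
    deriv_lambertCurve hv' h0, deriv_lambertCurve hv'' h0', lambertCurve_ofReal h0,
    lambertCurve_ofReal h0']
  have hne := slitPlane_add_ofReal_ne_zero hz (lambertCut_pos_of_pos hv).le
  have hne' : -(lambertCut v : ℂ) - z ≠ 0 := by
    rw [← neg_add', neg_ne_zero, add_comm]; exact hne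
  -- With `1 / sin² = 1 + cot²` everything becomes polynomial in `v` and `cot v`, and the weight
  -- appears as the imaginary part of `(1 + γ) γ'`.
  have hd : -Real.cot v + v / Real.sin v ^ 2 = -Real.cot v + v * (1 + Real.cot v ^ 2) := by
    rw [Real.cot_eq_cos_div_sin]
    field_simp
    linear_combination -v * Real.sin_sq_add_cos_sq v
  have hc : Real.cot (-v) = -Real.cot v := by simp [Real.cot_eq_cos_div_sin, div_neg]
  rw [Real.sin_neg, neg_sq, neg_div, hc, ← neg_add, hd, lambertWeight]
  have hzt : z + lambertCut v = -(-(lambertCut v : ℂ) - z) := by ring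
  rw [hzt, div_neg]
  push_cast
  generalize -(lambertCut v : ℂ) - z = D at hne'
  field_simp
  ring

theorem continuousOn_lambertCurve_integrand {z : ℂ} (hz : z ∈ Complex.slitPlane) :
    ContinuousOn (fun v : ℝ => (1 + lambertCurve v) /
      (lambertCurve v * Complex.exp (lambertCurve v) - z) * deriv lambertCurve v)
      (Ioo (-Real.pi) Real.pi) := by
  intro v hv
  have h1 := (hasDerivAt_lambertCurve hv).continuousAt
  refine (((continuousAt_const.add h1).div ((h1.mul h1.cexp).sub continuousAt_const) ?_).mul
    (hasDerivAt_deriv_lambertCurve hv).continuousAt).continuousWithinAt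
  obtain ⟨t, ht, he⟩ := exists_lambertCurve_mul_exp hv
  change lambertCurve v * Complex.exp (lambertCurve v) - z ≠ 0
  rw [he, ← neg_add', neg_ne_zero, add_comm]
  exact slitPlane_add_ofReal_ne_zero hz ht.le

theorem integral_lambertCurve_eq {z : ℂ} (hz : z ∈ Complex.slitPlane) {b : ℝ} (hb0 : 0 ≤ b)
    (hb : b < Real.pi) :
    ∫ v in -b..b, (1 + lambertCurve v) /
        (lambertCurve v * Complex.exp (lambertCurve v) - z) * deriv lambertCurve v =
      -2 * Complex.I * ∫ v in (0 : ℝ)..b, (lambertWeight v : ℂ) / (z + lambertCut v) := by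
  set f : ℝ → ℂ := fun v => (1 + lambertCurve v) /
        (lambertCurve v * Complex.exp (lambertCurve v) - z) * deriv lambertCurve v with hf
  have hc := continuousOn_lambertCurve_integrand hz
  have hπ := Real.pi_pos
  have hi : ∀ a c, a ∈ Ioo (-Real.pi) Real.pi → c ∈ Ioo (-Real.pi) Real.pi →
      IntervalIntegrable f volume a c := fun a c ha hc' =>
    (hc.mono ((ordConnected_Ioo).uIcc_subset ha hc')).intervalIntegrable
  have m0 : (0 : ℝ) ∈ Ioo (-Real.pi) Real.pi := ⟨by linarith, hπ⟩
  have mb : b ∈ Ioo (-Real.pi) Real.pi := ⟨by linarith, hb⟩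
  have mb' : -b ∈ Ioo (-Real.pi) Real.pi := ⟨by linarith, by linarith⟩
  have hneg : IntervalIntegrable (fun v => f (-v)) volume 0 b := by
    have := (hi 0 (-b) m0 mb').comp_sub_left 0
    simpa using this
  rw [← intervalIntegral.integral_add_adjacent_intervals (hi (-b) 0 mb' m0) (hi 0 b m0 mb)]
  have h1 : ∫ v in -b..0, f v = ∫ v in (0 : ℝ)..b, f (-v) := by
    rw [intervalIntegral.integral_comp_neg, neg_zero]
  rw [h1, ← intervalIntegral.integral_add hneg (hi 0 b m0 mb),
    ← intervalIntegral.integral_const_mul]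
  refine intervalIntegral.integral_congr_ae (ae_of_all _ fun v hv => ?_)
  rw [uIoc_of_le hb0] at hv
  have := lambertCurve_integrand_add_neg hz (v := v) ⟨hv.1, hv.2.trans_lt hb⟩
  rw [← this, add_comm]

/-! ### Bounds and integrability -/

theorem lambertWeight_nonneg (v : ℝ) : 0 ≤ lambertWeight v := by
  unfold lambertWeight; positivity

/-- With `x = 1 - v cot v ≥ 0`, the inequality `v / sin v ≥ 1` gives `exp x ≤ e * lambertCut v`, and
`x ^ 2 ≤ 2 exp x`. The remaining `v ^ 2` is at most `π ^ 2`. -/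
theorem lambertWeight_div_le {v : ℝ} (hv : v ∈ Ioo 0 Real.pi) :
    lambertWeight v / (1 + lambertCut v) ≤ Real.exp 1 * (Real.pi ^ 2 + 2) := by
  have hcut := lambertCut_pos_of_pos hv
  have hx := Real.mul_cot_le_one hv
  set x := 1 - v * Real.cot v with hxdef
  have hx0 : 0 ≤ x := by linarith
  have hs := Real.sin_pos_of_pos_of_lt_pi hv.1 hv.2
  have hv1 : 1 ≤ v * (1 / Real.sin v) := by
    rw [mul_one_div, one_le_div hs]
    exact Real.sin_le hv.1.le
  have hcut' : Real.exp x ≤ Real.exp 1 * lambertCut v := by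
    have h1 : Real.exp x = Real.exp 1 * Real.exp (-(v * Real.cot v)) := by
      rw [← Real.exp_add]; congr 1
    rw [h1, lambertCut]
    gcongr
    exact le_mul_of_one_le_left (Real.exp_pos _).le hv1
  have hq := Real.quadratic_le_exp_of_nonneg hx0
  have hv2 : v ^ 2 ≤ Real.pi ^ 2 := by
    have := hv.1.le; have := hv.2.le; gcongr
  have he := Real.add_one_le_exp (1 : ℝ)
  rw [div_le_iff₀ (by linarith), lambertWeight]
  have h2 : x ^ 2 ≤ 2 * (Real.exp 1 * lambertCut v) := by nlinarith
  have h3 : 1 ≤ Real.exp 1 * (1 + lambertCut v) := by nlinarith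
  have h4 := mul_le_mul_of_nonneg_left h3 (sq_nonneg Real.pi)
  nlinarith [Real.exp_pos 1]

/-- For `z ≠ 0` this is `‖z + t‖ ≥ cos (arg z / 2) (‖z‖ + t)`, squared; the two sides differ by
`(‖z‖ - z.re) (‖z‖ - t) ^ 2`. -/
theorem sq_norm_add_ofReal_ge (z : ℂ) (t : ℝ) :
    (‖z‖ + z.re) * (‖z‖ + t) ^ 2 ≤ 2 * ‖z‖ * ‖z + t‖ ^ 2 := by
  have h1 : ‖z + t‖ ^ 2 = ‖z‖ ^ 2 + 2 * z.re * t + t ^ 2 := by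
    rw [Complex.sq_norm, Complex.sq_norm, Complex.normSq_apply, Complex.normSq_apply]
    simp
    ring
  have h2 : 0 ≤ (‖z‖ - z.re) * (‖z‖ - t) ^ 2 :=
    mul_nonneg (sub_nonneg.2 (Complex.re_le_norm z)) (sq_nonneg _)
  rw [h1]
  linear_combination h2

theorem exists_le_norm_add_ofReal {z : ℂ} (hz : z ∈ Complex.slitPlane) :
    ∃ c : ℝ, 0 < c ∧ ∀ t : ℝ, 0 ≤ t → c * (1 + t) ≤ ‖z + t‖ := by
  have hr : 0 < ‖z‖ := norm_pos_iff.2 (Complex.slitPlane_ne_zero hz)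
  have h1 : 0 < ‖z‖ + z.re := by
    rcases Complex.mem_slitPlane_iff.1 hz with h | h
    · linarith
    · have := neg_abs_le z.re
      have := Complex.abs_re_lt_norm.2 h
      linarith
  set k := (‖z‖ + z.re) / (2 * ‖z‖) with hk
  have hk0 : 0 < k := by positivity
  refine ⟨Real.sqrt k * min 1 ‖z‖, mul_pos (Real.sqrt_pos.2 hk0) (lt_min one_pos hr),
    fun t ht => ?_⟩
  have h2 : k * (‖z‖ + t) ^ 2 ≤ ‖z + t‖ ^ 2 := by
    rw [hk, div_mul_eq_mul_div, div_le_iff₀ (by positivity)]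
    linarith [sq_norm_add_ofReal_ge z t]
  have h3 : min 1 ‖z‖ * (1 + t) ≤ ‖z‖ + t := by
    have := min_le_left 1 ‖z‖
    have := min_le_right 1 ‖z‖
    nlinarith
  calc Real.sqrt k * min 1 ‖z‖ * (1 + t) ≤ Real.sqrt k * (‖z‖ + t) := by
        rw [mul_assoc]; gcongr
    _ ≤ ‖z + t‖ := by
        refine abs_le_of_sq_le_sq' ?_ (norm_nonneg _) |>.2
        rwa [mul_pow, Real.sq_sqrt hk0.le]

theorem measurable_cot : Measurable Real.cot := by
  have : Real.cot = fun v => Real.cos v / Real.sin v := funext Real.cot_eq_cos_div_sin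
  rw [this]
  exact Real.measurable_cos.div Real.measurable_sin

theorem measurable_lambertCut : Measurable lambertCut :=
  (measurable_id.mul (Real.measurable_sin.const_div 1)).mul
    (measurable_id.mul measurable_cot).neg.exp

theorem measurable_lambertWeight : Measurable lambertWeight :=
  (measurable_id.pow_const 2).add ((measurable_const.sub
    (measurable_id.mul measurable_cot)).pow_const 2)

theorem integrableOn_lambert {z : ℂ} (hz : z ∈ Complex.slitPlane) :
    IntegrableOn (fun v : ℝ => (lambertWeight v : ℂ) / (z + lambertCut v)) (Ioo 0 Real.pi) := by
  obtain ⟨c, hc, hle⟩ := exists_le_norm_add_ofReal hz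
  refine Measure.integrableOn_of_bounded (M := Real.exp 1 * (Real.pi ^ 2 + 2) / c) (by simp)
    ((Complex.measurable_ofReal.comp measurable_lambertWeight).div
      (measurable_const.add (Complex.measurable_ofReal.comp
        measurable_lambertCut))).aestronglyMeasurable ?_
  refine (ae_restrict_mem measurableSet_Ioo).mono fun v hv => ?_
  have h1 := lambertCut_pos_of_pos hv
  have h2 := hle _ h1.le
  rw [norm_div, Complex.norm_real, Real.norm_of_nonneg (lambertWeight_nonneg v)]
  calc lambertWeight v / ‖z + lambertCut v‖ ≤ lambertWeight v / (c * (1 + lambertCut v)) := by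
        have := lambertWeight_nonneg v
        gcongr
    _ = lambertWeight v / (1 + lambertCut v) / c := by rw [div_div, mul_comm]
    _ ≤ _ := by
        have := lambertWeight_div_le hv
        gcongr

/-! ### The contour integral in the limit `b → π` -/

theorem tendsto_lambertCurve_re :
    Tendsto (fun b : ℝ => (lambertCurve b).re) (𝓝[<] Real.pi) atTop := by
  have hπ := Real.pi_pos
  have hmem : ∀ᶠ b in 𝓝[<] Real.pi, b ∈ Ioo 0 Real.pi := Ioo_mem_nhdsLT hπ
  have hsin : Tendsto (fun b : ℝ => (Real.sin b)⁻¹) (𝓝[<] Real.pi) atTop := by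
    refine tendsto_inv_nhdsGT_zero.comp (tendsto_nhdsWithin_iff.2 ⟨?_, ?_⟩)
    · simpa using (Real.continuous_sin.tendsto Real.pi).mono_left nhdsWithin_le_nhds
    · filter_upwards [hmem] with b hb
      exact Real.sin_pos_of_pos_of_lt_pi hb.1 hb.2
  have hcos : Tendsto (fun b : ℝ => -(b * Real.cos b)) (𝓝[<] Real.pi) (𝓝 Real.pi) := by
    have h : Continuous fun b : ℝ => -(b * Real.cos b) := by fun_prop
    simpa using (h.tendsto Real.pi).mono_left nhdsWithin_le_nhds
  refine (hcos.pos_mul_atTop hπ hsin).congr' ?_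
  filter_upwards [hmem] with b hb
  rw [lambertCurve_re hb.1.ne', Real.cot_eq_cos_div_sin]
  ring

/-- The two horizontal sides together contribute `O(1 / Re γ(b))`. -/
theorem norm_regular_part_sub_le {G : ℂ → ℂ} {w z : ℂ}
    (hG : ∀ ζ ∈ lambertRegion, ζ ≠ w →
      G ζ = (1 + ζ) / (ζ * Complex.exp ζ - z) - Complex.exp (-w) / (ζ - w))
    {b s : ℝ} (hb0 : 0 ≤ b) (hb : b < Real.pi) (hs : 0 ≤ s) (h1 : 1 ≤ (lambertCurve b).re)
    (h2 : 2 * ‖z‖ ≤ (lambertCurve b).re) (h3 : 2 * |w.re| ≤ (lambertCurve b).re) :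
    ‖G (s + lambertCurve b) - G (s + lambertCurve (-b : ℝ))‖ ≤
      (16 + 8 * Real.pi * ‖Complex.exp (-w)‖) / (s + (lambertCurve b).re) ^ 2 := by
  set c := Complex.exp (-w) with hc
  set p := s + lambertCurve b with hp
  set p' := s + lambertCurve (-b : ℝ) with hp'
  have mp : p ∈ lambertRegion := add_lambertCurve_mem_lambertRegion hs ⟨by linarith, hb⟩
  have mp' : p' ∈ lambertRegion :=
    add_lambertCurve_mem_lambertRegion hs ⟨by linarith, by linarith⟩
  set x := s + (lambertCurve b).re with hx
  have rp : p.re = x := by simp [hp, hx]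
  have rp' : p'.re = x := by rw [hp', lambertCurve_neg]; simp [hx]
  have hx1 : 1 ≤ x := by linarith
  have hxz : 2 * ‖z‖ ≤ x := by linarith
  have hxw : x / 2 ≤ x - w.re := by linarith [le_abs_self w.re]
  have np : x / 2 ≤ ‖p - w‖ := by
    refine hxw.trans (le_trans (le_of_eq ?_) (Complex.re_le_norm _)); simp [rp]
  have np' : x / 2 ≤ ‖p' - w‖ := by
    refine hxw.trans (le_trans (le_of_eq ?_) (Complex.re_le_norm _)); simp [rp']
  have ne : p - w ≠ 0 := norm_pos_iff.1 (by linarith)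
  have ne' : p' - w ≠ 0 := norm_pos_iff.1 (by linarith)
  have f1 := norm_one_add_div_mul_exp_sub_le (z := z) (ζ := p) (by rwa [rp]) (by rwa [rp])
  have f2 := norm_one_add_div_mul_exp_sub_le (z := z) (ζ := p') (by rwa [rp']) (by rwa [rp'])
  rw [rp] at f1
  rw [rp'] at f2
  have hpp : ‖p - p'‖ ≤ 2 * Real.pi := by
    rw [hp, hp', add_sub_add_left_eq_sub]
    exact norm_lambertCurve_sub_neg_le hb0 hb
  -- Each polar term alone is only `O(1/x)`, which is not integrable in `s`. The difference gains a
  -- power because `p` and `p'` stay within `2π` of each other.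
  have f3 : ‖c / (p - w) - c / (p' - w)‖ ≤ ‖c‖ * (2 * Real.pi) / (x / 2 * (x / 2)) := by
    rw [div_sub_div _ _ ne ne', norm_div, norm_mul (p - w)]
    have : c * (p' - w) - (p - w) * c = -(c * (p - p')) := by ring
    rw [this, norm_neg, norm_mul]
    gcongr
  rw [hG p mp (sub_ne_zero.1 ne), hG p' mp' (sub_ne_zero.1 ne')]
  set A := (1 + p) / (p * Complex.exp p - z)
  set B := (1 + p') / (p' * Complex.exp p' - z)
  calc ‖A - c / (p - w) - (B - c / (p' - w))‖
      = ‖A - B - (c / (p - w) - c / (p' - w))‖ := by congr 1; ring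
    _ ≤ ‖A‖ + ‖B‖ + ‖c / (p - w) - c / (p' - w)‖ :=
      (norm_sub_le _ _).trans (add_le_add_left (norm_sub_le _ _) _)
    _ ≤ 8 / x ^ 2 + 8 / x ^ 2 + ‖c‖ * (2 * Real.pi) / (x / 2 * (x / 2)) := by gcongr
    _ = _ := by
      have : x ≠ 0 := by linarith
      field_simp
      ring

/-- For fixed `b` the curve has bounded speed, and `G` is `O(1/S)` on its translate, the polar term
being the slower one to decay. -/
theorem tendsto_integral_regular_part {G : ℂ → ℂ} {w z : ℂ}
    (hG : ∀ ζ ∈ lambertRegion, ζ ≠ w →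
      G ζ = (1 + ζ) / (ζ * Complex.exp ζ - z) - Complex.exp (-w) / (ζ - w))
    {b : ℝ} (hb0 : 0 ≤ b) (hb : b < Real.pi) :
    Tendsto (fun S : ℝ => ∫ v in -b..b, G (S + lambertCurve v) * deriv lambertCurve v) atTop
      (𝓝 0) := by
  have hsub := Icc_neg_subset_Ioo_pi hb
  obtain ⟨M, hM⟩ := isCompact_Icc.exists_bound_of_continuousOn
    (f := fun v : ℝ => deriv lambertCurve v) (s := Icc (-b) b)
    fun v hv => (hasDerivAt_deriv_lambertCurve (hsub hv)).continuousAt.continuousWithinAt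
  have hM0 : 0 ≤ M := (norm_nonneg _).trans (hM 0 ⟨by linarith, hb0⟩)
  set c := Complex.exp (-w) with hc
  have hlim : Tendsto (fun S : ℝ => ((8 + 2 * ‖c‖) / (S - 1)) * M * |b - -b|) atTop (𝓝 0) := by
    have h1 : Tendsto (fun S : ℝ => S - 1) atTop atTop :=
      tendsto_atTop_add_const_right _ _ tendsto_id
    simpa using ((tendsto_const_nhds (x := 8 + 2 * ‖c‖)).div_atTop h1).mul_const M |>.mul_const
      |b - -b|
  refine squeeze_zero_norm' ?_ hlim
  filter_upwards [eventually_ge_atTop (2 + 2 * ‖z‖ + 2 * |w.re|)] with S hS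
  refine intervalIntegral.norm_integral_le_of_norm_le_const fun v hv => ?_
  rw [uIoc_of_le (by linarith)] at hv
  have hv' := hsub (Ioc_subset_Icc_self hv)
  have hz0 := norm_nonneg z
  have hw0 := abs_nonneg w.re
  have mp := add_lambertCurve_mem_lambertRegion (s := S) (by linarith) hv'
  set p := S + lambertCurve v with hp
  have rp : S - 1 ≤ p.re := by
    have := neg_one_le_lambertCurve_re hv'
    simp only [hp, Complex.add_re, Complex.ofReal_re]
    linarith
  have np : p.re / 2 ≤ ‖p - w‖ := by
    refine le_trans ?_ (Complex.re_le_norm _)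
    rw [Complex.sub_re]
    linarith [le_abs_self w.re]
  have ne : p ≠ w := sub_ne_zero.1 (norm_pos_iff.1 (by linarith))
  have f1 := norm_one_add_div_mul_exp_sub_le (z := z) (ζ := p) (by linarith) (by linarith)
  rw [norm_mul, hG p mp ne]
  refine mul_le_mul ?_ (hM v (Ioc_subset_Icc_self hv)) (norm_nonneg _)
    (div_nonneg (by positivity) (by linarith))
  have hpos : 0 < S - 1 := by linarith
  have hpos' : 0 < p.re := by linarith
  calc _ ≤ 8 / p.re ^ 2 + ‖c‖ / (p.re / 2) := by
        refine (norm_sub_le _ _).trans (add_le_add f1 ?_)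
        rw [norm_div]
        gcongr
    _ ≤ 8 / p.re + ‖c‖ / (p.re / 2) := by
        gcongr
        nlinarith
    _ = (8 + 2 * ‖c‖) / p.re := by field_simp
    _ ≤ _ := by gcongr

/-- Translate the curve by `S → ∞`: the translated integral vanishes, and the two sides together
cost at most `∫ C / (s + x) ^ 2 ds = C / x` over `s ≥ 0`, where `x = Re γ(b)`. -/
theorem norm_integral_regular_part_le {G : ℂ → ℂ} {w z : ℂ}
    (hGd : ∀ ζ ∈ lambertRegion, DifferentiableAt ℂ G ζ)
    (hG : ∀ ζ ∈ lambertRegion, ζ ≠ w →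
      G ζ = (1 + ζ) / (ζ * Complex.exp ζ - z) - Complex.exp (-w) / (ζ - w))
    {b : ℝ} (hb0 : 0 ≤ b) (hb : b < Real.pi) (h1 : 1 ≤ (lambertCurve b).re)
    (h2 : 2 * ‖z‖ ≤ (lambertCurve b).re) (h3 : 2 * |w.re| ≤ (lambertCurve b).re) :
    ‖∫ v in -b..b, G (lambertCurve v) * deriv lambertCurve v‖ ≤
      (16 + 8 * Real.pi * ‖Complex.exp (-w)‖) / (lambertCurve b).re := by
  set C := 16 + 8 * Real.pi * ‖Complex.exp (-w)‖ with hC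
  have hC0 : 0 ≤ C := by positivity
  set x := (lambertCurve b).re with hx
  have hx0 : 0 < x := by linarith
  have hsub := Icc_neg_subset_Ioo_pi hb
  have mb : b ∈ Ioo (-Real.pi) Real.pi := ⟨by linarith, hb⟩
  have mb' : -b ∈ Ioo (-Real.pi) Real.pi := ⟨by linarith, by linarith⟩
  have hint : ∀ v ∈ Ioo (-Real.pi) Real.pi, ∀ S : ℝ, 0 ≤ S →
      IntervalIntegrable (fun s : ℝ => G (s + lambertCurve v)) volume 0 S := by
    intro v hv S hS
    refine ContinuousOn.intervalIntegrable fun s hs => ContinuousAt.continuousWithinAt ?_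
    rw [uIcc_of_le hS] at hs
    exact ContinuousAt.comp (f := fun s : ℝ => (s : ℂ) + lambertCurve v)
      (hGd _ (add_lambertCurve_mem_lambertRegion hs.1 hv)).continuousAt (by fun_prop)
  have hsides : ∀ S : ℝ, 0 ≤ S →
      ‖∫ s in (0 : ℝ)..S, (G (s + lambertCurve b) - G (s + lambertCurve (-b : ℝ)))‖ ≤ C / x := by
    intro S hS
    have hd : ∀ s ∈ uIcc 0 S, HasDerivAt (fun s : ℝ => -(C / (s + x))) (C / (s + x) ^ 2) s := by
      intro s hs
      rw [uIcc_of_le hS] at hs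
      have : s + x ≠ 0 := by linarith [hs.1]
      refine ((((hasDerivAt_id s).add_const x).inv this).const_mul C).neg.congr_deriv ?_
      simp only [id]
      field_simp
    have hci : IntervalIntegrable (fun s : ℝ => C / (s + x) ^ 2) volume 0 S := by
      refine ContinuousOn.intervalIntegrable (continuousOn_const.div (by fun_prop) fun s hs => ?_)
      rw [uIcc_of_le hS] at hs
      have : 0 < s + x := by linarith [hs.1]
      positivity
    calc _ ≤ ∫ s in (0 : ℝ)..S, C / (s + x) ^ 2 := by
          refine intervalIntegral.norm_integral_le_of_norm_le hS (ae_of_all _ fun s hs => ?_) hci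
          exact norm_regular_part_sub_le hG hb0 hb hs.1.le h1 h2 h3
      _ = C / x - C / (S + x) := by
          rw [intervalIntegral.integral_eq_sub_of_hasDerivAt hd hci, zero_add]; ring
      _ ≤ C / x := by
          have : 0 ≤ C / (S + x) := by positivity
          linarith
  have hlim := (tendsto_integral_regular_part hG hb0 hb).norm.add_const (C / x)
  rw [norm_zero, zero_add] at hlim
  refine ge_of_tendsto hlim ?_
  filter_upwards [eventually_ge_atTop 0] with S hS
  rw [integral_curve_eq_integral_translate (S := S) (γ := fun v : ℝ => lambertCurve v)
    (γ' := fun v : ℝ => deriv lambertCurve v) (by linarith) hS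
    (fun v hv => hasDerivAt_lambertCurve (hsub hv))
    (fun v hv => hasDerivAt_deriv_lambertCurve (hsub hv))
    (fun s hs v hv => hGd _ (add_lambertCurve_mem_lambertRegion hs (hsub hv))),
    sub_add, ← intervalIntegral.integral_sub (hint b mb S hS) (hint (-b) mb' S hS)]
  exact (norm_sub_le _ _).trans (add_le_add_right (hsides S hS) _)

/-- The residue theorem for the boundary curve of the region. -/
theorem tendsto_integral_lambertCurve {w : ℂ} (hw : w ∈ lambertRegion)
    (hz : w * Complex.exp w ∈ Complex.slitPlane) :
    Tendsto (fun b : ℝ => ∫ v in -b..b, (1 + lambertCurve v) /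
        (lambertCurve v * Complex.exp (lambertCurve v) - w * Complex.exp w)
          * deriv lambertCurve v)
      (𝓝[<] Real.pi) (𝓝 (-2 * Real.pi * Complex.I * Complex.exp (-w))) := by
  obtain ⟨G, hGd, hG⟩ := exists_regular_part hw hz
  set z := w * Complex.exp w with hzdef
  set c := Complex.exp (-w) with hc
  have hπ := Real.pi_pos
  have hre := tendsto_lambertCurve_re
  have hlim : Tendsto (fun b : ℝ => (16 + 8 * Real.pi * ‖c‖) / (lambertCurve b).re +
      ‖c‖ * (2 * Real.pi / ((lambertCurve b).re - w.re))) (𝓝[<] Real.pi) (𝓝 0) := by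
    simpa [sub_eq_add_neg] using (tendsto_const_nhds.div_atTop hre).add
      ((tendsto_const_nhds.div_atTop (tendsto_atTop_add_const_right _ (-w.re) hre)).const_mul ‖c‖)
  rw [tendsto_iff_norm_sub_tendsto_zero]
  refine squeeze_zero' (Eventually.of_forall fun b => norm_nonneg _) ?_ hlim
  have hwπ : |w.im| < Real.pi := abs_lt.2 (lambertRegion_im_mem hw)
  filter_upwards [Ioo_mem_nhdsLT hwπ, hre.eventually_ge_atTop 1,
    hre.eventually_ge_atTop (2 * ‖z‖), hre.eventually_ge_atTop (2 * |w.re|),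
    hre.eventually_gt_atTop w.re] with b hb h1 h2 h3 h4
  have hb0 : 0 < b := (abs_nonneg _).trans_lt hb.1
  have hsub := Icc_neg_subset_Ioo_pi hb.2
  have n1 := norm_integral_regular_part_le hGd hG hb0.le hb.2 h1 h2 h3
  have n2 := norm_log_lambertCurve_add_le hb0 hb.2 hb.1 h4
  rw [← integral_lambertCurve_inv_sub hw hz hb0.le hb.2] at n2
  have hi1 : IntervalIntegrable (fun v : ℝ => G (lambertCurve v) * deriv lambertCurve v)
      volume (-b) b := by
    refine ContinuousOn.intervalIntegrable fun v hv => ContinuousAt.continuousWithinAt ?_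
    rw [uIcc_of_le (by linarith)] at hv
    have hv' := hsub hv
    exact (ContinuousAt.comp (f := fun v : ℝ => lambertCurve v)
      (hGd _ (lambertCurve_mem_lambertRegion hv')).continuousAt
      (hasDerivAt_lambertCurve hv').continuousAt).mul
      (hasDerivAt_deriv_lambertCurve hv').continuousAt
  have hne : ∀ v ∈ Icc (-b) b, lambertCurve v - w ≠ 0 := fun v hv => by
    have := Complex.slitPlane_ne_zero (sub_lambertCurve_mem_slitPlane hw hz (hsub hv))
    exact sub_ne_zero.2 (sub_ne_zero.1 this).symm
  have hi2 : IntervalIntegrable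
      (fun v : ℝ => c * ((lambertCurve v - w)⁻¹ * deriv lambertCurve v)) volume (-b) b := by
    refine ContinuousOn.intervalIntegrable fun v hv => ContinuousAt.continuousWithinAt ?_
    rw [uIcc_of_le (by linarith)] at hv
    have hv' := hsub hv
    exact continuousAt_const.mul ((((hasDerivAt_lambertCurve hv').continuousAt.sub
      continuousAt_const).inv₀ (hne v hv)).mul (hasDerivAt_deriv_lambertCurve hv').continuousAt)
  have hsplit : ∫ v in -b..b, (1 + lambertCurve v) /
        (lambertCurve v * Complex.exp (lambertCurve v) - z) * deriv lambertCurve v =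
      (∫ v in -b..b, G (lambertCurve v) * deriv lambertCurve v) +
        c * ∫ v in -b..b, (lambertCurve v - w)⁻¹ * deriv lambertCurve v := by
    rw [← intervalIntegral.integral_const_mul, ← intervalIntegral.integral_add hi1 hi2]
    refine intervalIntegral.integral_congr fun v hv => ?_
    rw [uIcc_of_le (by linarith)] at hv
    rw [hG _ (lambertCurve_mem_lambertRegion (hsub hv)) (sub_ne_zero.1 (hne v hv))]
    ring
  rw [hsplit]
  set P := ∫ v in -b..b, G (lambertCurve v) * deriv lambertCurve v
  set Q := ∫ v in -b..b, (lambertCurve v - w)⁻¹ * deriv lambertCurve v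
  calc ‖P + c * Q - -2 * Real.pi * Complex.I * c‖
      = ‖P + c * (Q + 2 * Real.pi * Complex.I)‖ := by congr 1; ring
    _ ≤ ‖P‖ + ‖c‖ * ‖Q + 2 * Real.pi * Complex.I‖ := by
      rw [← norm_mul]; exact norm_add_le _ _
    _ ≤ _ := by gcongr

theorem lambertW_div_eq {z : ℂ} (hz : z ∈ Complex.slitPlane) :
    lambertW z / z = 1 / (Real.pi : ℂ) *
      ∫ v in (0 : ℝ)..Real.pi, (lambertWeight v : ℂ) / (z + lambertCut v) := by
  have hπ := Real.pi_pos
  have hw := lambertW_mem_lambertRegion hz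
  have hwz := lambertW_mul_exp hz
  set w := lambertW z
  have hz' : w * Complex.exp w ∈ Complex.slitPlane := by rwa [hwz]
  have h1 := tendsto_integral_lambertCurve hw hz'
  rw [hwz] at h1
  have hint : IntegrableOn (fun v : ℝ => (lambertWeight v : ℂ) / (z + lambertCut v))
      (uIcc 0 Real.pi) := by
    rw [uIcc_of_le hπ.le, integrableOn_Icc_iff_integrableOn_Ioo]
    exact integrableOn_lambert hz
  have h2 : Tendsto (fun b : ℝ => -2 * Complex.I *
      ∫ v in (0 : ℝ)..b, (lambertWeight v : ℂ) / (z + lambertCut v)) (𝓝[<] Real.pi)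
      (𝓝 (-2 * Complex.I *
        ∫ v in (0 : ℝ)..Real.pi, (lambertWeight v : ℂ) / (z + lambertCut v))) := by
    have h3 := intervalIntegral.continuousOn_primitive_interval hint Real.pi right_mem_uIcc
    refine (Tendsto.mono_left h3 ?_).const_mul _
    rw [uIcc_of_le hπ.le, nhdsWithin_Icc_eq_nhdsLE hπ]
    exact nhdsWithin_mono _ Iio_subset_Iic_self
  have h4 := tendsto_nhds_unique (h1.congr' ?_) h2
  · have hπ' : (Real.pi : ℂ) ≠ 0 := by exact_mod_cast hπ.ne'
    have hw0 : w ≠ 0 := fun h => Complex.slitPlane_ne_zero hz (by rw [← hwz, h, zero_mul])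
    have hI := Complex.I_ne_zero
    have h5 : (∫ v in (0 : ℝ)..Real.pi, (lambertWeight v : ℂ) / (z + lambertCut v)) =
        Real.pi * Complex.exp (-w) := by
      refine mul_left_cancel₀ (mul_ne_zero (by norm_num : (-2 : ℂ) ≠ 0) hI) ?_
      rw [← h4]; ring
    -- Since `z = w * exp w`, the quotient `w / z` is `exp (-w)`.
    rw [h5, ← hwz, Complex.exp_neg]
    have := Complex.exp_ne_zero w
    field_simp
  · filter_upwards [Ioo_mem_nhdsLT hπ] with b hb
    exact integral_lambertCurve_eq hz hb.1.le hb.2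

/-! ### The Stieltjes measure and the theorem -/

theorem mem_slitPlane_of_abs_arg_lt {z : ℂ} (h0 : z ≠ 0) (h : |z.arg| < Real.pi) :
    z ∈ Complex.slitPlane :=
  Complex.mem_slitPlane_iff_arg.2 ⟨(lt_of_abs_lt h).ne, h0⟩

/-- The measure of the Stieltjes representation of `W(z) / z`. -/
noncomputable def lambertMeasure : Measure ℝ :=
  Measure.map lambertCut ((volume.restrict (Ioo 0 Real.pi)).withDensity
    fun v : ℝ => ENNReal.ofReal (1 / Real.pi * lambertWeight v))

theorem measurable_lambertDensity :
    Measurable fun v : ℝ => ENNReal.ofReal (1 / Real.pi * lambertWeight v) :=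
  (measurable_lambertWeight.const_mul _).ennreal_ofReal

theorem lambertMeasure_Iio : lambertMeasure (Iio 0) = 0 := by
  rw [lambertMeasure, Measure.map_apply measurable_lambertCut measurableSet_Iio]
  refine withDensity_absolutelyContinuous _ _ ?_
  rw [Measure.restrict_apply (measurable_lambertCut measurableSet_Iio)]
  convert measure_empty (μ := (volume : Measure ℝ))
  refine eq_empty_iff_forall_notMem.2 fun v hv => ?_
  exact lt_asymm hv.1 (lambertCut_pos_of_pos hv.2)

theorem lintegral_lambertMeasure_lt_top :
    ∫⁻ t, ENNReal.ofReal (1 / (1 + t)) ∂lambertMeasure < ⊤ := by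
  have hm : Measurable fun t : ℝ => ENNReal.ofReal (1 / (1 + t)) := by fun_prop
  rw [lambertMeasure, lintegral_map hm measurable_lambertCut,
    lintegral_withDensity_eq_lintegral_mul _ measurable_lambertDensity
      (show Measurable fun v => ENNReal.ofReal (1 / (1 + lambertCut v)) from
        hm.comp measurable_lambertCut)]
  refine (setLIntegral_mono (g := fun _ => ENNReal.ofReal
    (1 / Real.pi * (Real.exp 1 * (Real.pi ^ 2 + 2)))) measurable_const fun v hv => ?_).trans_lt ?_
  · have h1 := lambertWeight_nonneg v
    have hπ := Real.pi_pos
    simp only [Pi.mul_apply]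
    rw [← ENNReal.ofReal_mul (by positivity)]
    refine ENNReal.ofReal_le_ofReal ?_
    rw [mul_assoc, mul_one_div]
    have := lambertWeight_div_le hv
    gcongr
  · rw [setLIntegral_const]
    exact ENNReal.mul_lt_top ENNReal.ofReal_lt_top (by simp)

theorem integrable_lambertMeasure {z : ℂ} (hz : z ∈ Complex.slitPlane) :
    Integrable (fun t : ℝ => 1 / (z + (t : ℂ))) lambertMeasure ∧
      ∫ t : ℝ, 1 / (z + (t : ℂ)) ∂lambertMeasure = 1 / (Real.pi : ℂ) *
        ∫ v in (0 : ℝ)..Real.pi, (lambertWeight v : ℂ) / (z + lambertCut v) := by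
  have hm : Measurable fun t : ℝ => 1 / (z + (t : ℂ)) :=
    (measurable_const.add Complex.measurable_ofReal).const_div 1
  have hfin : ∀ᵐ v ∂(volume.restrict (Ioo 0 Real.pi)),
      ENNReal.ofReal (1 / Real.pi * lambertWeight v) < ⊤ :=
    ae_of_all _ fun v => ENNReal.ofReal_lt_top
  have heq : ∀ v : ℝ, (ENNReal.ofReal (1 / Real.pi * lambertWeight v)).toReal •
      (1 / (z + (lambertCut v : ℂ))) =
      1 / (Real.pi : ℂ) * ((lambertWeight v : ℂ) / (z + lambertCut v)) := fun v => by
    rw [ENNReal.toReal_ofReal (mul_nonneg (by positivity) (lambertWeight_nonneg v)),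
      Complex.real_smul]
    push_cast
    ring
  constructor
  · rw [lambertMeasure, integrable_map_measure hm.aestronglyMeasurable
      measurable_lambertCut.aemeasurable,
      integrable_withDensity_iff_integrable_smul' measurable_lambertDensity hfin]
    simp only [Function.comp_apply, heq]
    exact (integrableOn_lambert hz).const_mul _
  · rw [lambertMeasure, integral_map measurable_lambertCut.aemeasurable hm.aestronglyMeasurable,
      integral_withDensity_eq_integral_toReal_smul measurable_lambertDensity hfin]
    simp only [heq]
    rw [integral_const_mul, intervalIntegral.integral_of_le Real.pi_pos.le,
      integral_Ioc_eq_integral_Ioo]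

theorem mainTheorem4 :
    (∀ z : ℂ, z ≠ 0 → |z.arg| < Real.pi →
      IntervalIntegrable
        (fun v : ℝ => ((v ^ 2 + (1 - v * Real.cot v) ^ 2 : ℝ) : ℂ) /
          (z + ((v * (1 / Real.sin v) * Real.exp (-(v * Real.cot v)) : ℝ) : ℂ)))
        volume 0 Real.pi ∧
      lambertW z / z = 1 / (Real.pi : ℂ) *
        ∫ v in (0 : ℝ)..Real.pi, ((v ^ 2 + (1 - v * Real.cot v) ^ 2 : ℝ) : ℂ) /
          (z + ((v * (1 / Real.sin v) * Real.exp (-(v * Real.cot v)) : ℝ) : ℂ))) ∧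
    HasStieltjesRepresentation (fun z => lambertW z / z) 0
      (Measure.map (fun v : ℝ => v * (1 / Real.sin v) * Real.exp (-(v * Real.cot v)))
        ((volume.restrict (Set.Ioo 0 Real.pi)).withDensity
          (fun v : ℝ => ENNReal.ofReal (1 / Real.pi * (v ^ 2 + (1 - v * Real.cot v) ^ 2))))) := by
  refine ⟨fun z h0 h => ?_, le_rfl, lambertMeasure_Iio, lintegral_lambertMeasure_lt_top,
    fun z h0 h => ?_⟩
  · have hz := mem_slitPlane_of_abs_arg_lt h0 h
    refine ⟨?_, lambertW_div_eq hz⟩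
    rw [intervalIntegrable_iff_integrableOn_Ioo_of_le Real.pi_pos.le]
    exact integrableOn_lambert hz
  · have hz := mem_slitPlane_of_abs_arg_lt h0 h
    obtain ⟨h1, h2⟩ := integrable_lambertMeasure hz
    refine ⟨h1, ?_⟩
    rw [Complex.ofReal_zero, zero_add]
    exact (lambertW_div_eq hz).trans h2.symm
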